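/- A finite Bayesian game $\mathcal G(M,N,C,\mathcal D,u_O,u_L)$ has $M\ge 1$ optimizer actions, $N\ge 1$ learner actions, $C\ge 1$ contexts with prior $\mathcal D=(p_c)_{c\in[C]}$, and utilities $u_O,u_L:[M]\times[N]\times[C]\to[-1,1]$. A pure strategy of the learner is a map $f:[C]\to[N]$, a mixed strategy is a distribution $\beta\in\Delta([N]^{[C]})$; for $u\in\{u_O,u_L\}$ put $u(i,f)=\sum_c p_c\,u(i,f(c),c)$ and extend linearly to $u(\alpha,f)$, $\alpha\in\Delta([M])$, and $u(i,\beta)$. The Stackelberg utility $V(\mathcal G)$ is the maximum of $u_O(\alpha,f)$ over all $\alpha\in\Delta([M])$ and all best responses $f\in\operatorname{argmax}_{f'}u_L(\alpha,f')$. Mixed strategies $\beta,\rho$ are equivalent, $\rho\in[\beta]$, if $\sum_{f:f(c)=j}\beta_f=\sum_{f:f(c)=j}\rho_f$ for all $c,j$. If in $T$ rounds the optimizer plays $i_1,\dots,i_T$ and the learner uses $\beta_1,\dots,\beta_T$, the polytope swap regret is $$\mathrm{Reg}_{\mathrm{poly}}=\min_{\rho_t\in[\beta_t]\ \forall t}\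 \max_{\pi:[N]^{[C]}\to[N]^{[C]}}\ \sum_{t=1}^T\Big(\sum_f\rho_{t,f}\,u_L(i_t,\pi(f))-u_L(i_t,\beta_t)\Big).$$ A reward-based algorithm $\mathcal A$ chooses $\beta_t$ as a deterministic function of $T,N,C$, the prior $\mathcal D$ and the reward vectors $(u_L(i_s,j,c))_{j,c}$ of the earlier rounds $s<t$. Theorem. Let $\mathcal A$ be a reward-based algorithm. For each horizon $T$ let $\mathcal G_T(M_T,N_T,C_T,\mathcal D_T,u_{O},u_{L})$ be a Bayesian game with utilities in $[-1,1]$ and let $i_1,\dots,i_T\in[M_T]$ be optimizer actions (all depending on $T$). Suppose that $\mathcal G_T$ has no negligible context, i.e. there is a constant $\delta>0$ such that, for all sufficiently large $T$, $p_c\ge\delta$ for every context $c$ of $\mathcal G_T$; and that the polytope swap regret of $\mathcal A$ against $i_1,\dots,i_T$ in $\mathcal G_T$ repeated for $T$ rounds is $\Omega(T)$ as $T\to\infty$. Then $\mathcal A$ is exploitable, by games with $T$ optimizer actions: there are Bayesian games $\mathcal G'_T(T,N_T,C_T,\mathcal D_T,u_O',u_L')$ with utilities in $[-1,1]$ and optimizer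 actions $i_1',\dots,i_T'\in[T]$ such that (i) $u_L'(i_t',j,c)=u_L(i_t,j,c)$ for all $t\in[T]$, $j\in[N_T]$, $c\in[C_T]$; and (ii) the optimizer's total expected utility $\sum_{t=1}^T u_O'(i_t',\beta_t')$, where $\beta_t'$ are the mixed strategies that $\mathcal A$ uses against $i_1',\dots,i_T'$ in $\mathcal G'_T$, is $V(\mathcal G'_T)\cdot T+\Omega(T)$ as $T\to\infty$. -/

import Mathlib

open Filter

noncomputable section

namespace BayesGame

/-- A probability distribution on the finite set `X`. -/
abbrev Dist (X : Type) [Fintype X] : Type := stdSimplex ℝ X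

/-- A pure strategy of the learner: a map from contexts to the learner's actions. -/
abbrev PureStrategy (N C : ℕ) : Type := Fin C → Fin N

/-- A mixed strategy of the learner: a distribution over pure strategies. -/
abbrev MixedStrategy (N C : ℕ) : Type := Dist (PureStrategy N C)

/-- A utility function: it takes the optimizer's action, the learner's action and the context. -/
abbrev Utility (M N C : ℕ) : Type := Fin M → Fin N → Fin C → ℝ

/-- A finite Bayesian game with `M` optimizer actions, `N` learner actions and `C` contexts. -/
structure Game (M N C : ℕ) where
  /-- the distribution of the learner's context -/
  prior : Dist (Fin C)
  /-- the optimizer's utility -/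
  uO : Utility M N C
  /-- the learner's utility -/
  uL : Utility M N C

/-- Expected utility `u(i, f)` of an optimizer action `i` against a pure strategy `f`. -/
def utilPP {M N C : ℕ} (p : Dist (Fin C)) (u : Utility M N C)
    (i : Fin M) (f : PureStrategy N C) : ℝ :=
  ∑ c, p c * u i (f c) c

/-- Expected utility `u(α, f)` of an optimizer mixed strategy `α` against a pure strategy `f`. -/
def utilMP {M N C : ℕ} (p : Dist (Fin C)) (u : Utility M N C)
    (α : Dist (Fin M)) (f : PureStrategy N C) : ℝ :=
  ∑ i, α i * utilPP p u i f

/-- Expected utility `u(i, β)` of an optimizer action `i` against a mixed strategy `β`. -/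
def utilPM {M N C : ℕ} (p : Dist (Fin C)) (u : Utility M N C)
    (i : Fin M) (β : MixedStrategy N C) : ℝ :=
  ∑ f, β f * utilPP p u i f

namespace Game

variable {M N C : ℕ} (G : Game M N C)

/-- Both utility functions take values in `[-1, 1]`. -/
def Normalized : Prop :=
  ∀ i j c, G.uO i j c ∈ Set.Icc (-1 : ℝ) 1 ∧ G.uL i j c ∈ Set.Icc (-1 : ℝ) 1

/-- The pure strategy `f` of the learner is a best response to `α`. -/
def IsBestResponse (α : Dist (Fin M)) (f : PureStrategy N C) : Prop :=
  ∀ f' : PureStrategy N C, utilMP G.prior G.uL α f' ≤ utilMP G.prior G.uL α f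

/-- The values `u_O(α, f)` over all pairs in which `f` is a best response to `α`. -/
def stackelbergValues : Set ℝ :=
  {v | ∃ (α : Dist (Fin M)) (f : PureStrategy N C),
    G.IsBestResponse α f ∧ v = utilMP G.prior G.uO α f}

/-- The Stackelberg utility `V(G)`. If both players have at least one action, the supremum is a
maximum, see `isGreatest_stackelbergUtility`. -/
def stackelbergUtility : ℝ := sSup G.stackelbergValues

end Game

/-- The two mixed strategies induce the same distribution of the learner's action in every
context. -/
def Equivalent {N C : ℕ} (β ρ : MixedStrategy N C) : Prop :=
  ∀ (c : Fin C) (j : Fin N),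
    ∑ f : PureStrategy N C with f c = j, β f = ∑ f : PureStrategy N C with f c = j, ρ f

/-- The gain of the learner from applying the swap `π` to the representatives `ρ t` of the mixed
strategies `β t`, when the optimizer plays `i t` at round `t`. -/
def swapGain {M N C T : ℕ} (G : Game M N C) (i : Fin T → Fin M) (β ρ : Fin T → MixedStrategy N C)
    (π : PureStrategy N C → PureStrategy N C) : ℝ :=
  ∑ t, (∑ f, ρ t f * utilPP G.prior G.uL (i t) (π f) - utilPM G.prior G.uL (i t) (β t))

/-- The polytope swap regret: minimum over representatives `ρ t` equivalent to `β t` of the maximal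
gain of a swap. The infimum is a minimum, see `exists_polytopeSwapRegret_eq`. -/
def polytopeSwapRegret {M N C T : ℕ} (G : Game M N C) (i : Fin T → Fin M)
    (β : Fin T → MixedStrategy N C) : ℝ :=
  ⨅ ρ : {ρ : Fin T → MixedStrategy N C // ∀ t, Equivalent (β t) (ρ t)},
    ⨆ π : PureStrategy N C → PureStrategy N C, swapGain G i β ρ π

/-- A reward-based learning algorithm. Given the number of rounds and the numbers of actions and
contexts, the mixed strategy at round `t` is a function of the prior distribution and of the reward
vectors of the rounds before `t`. -/
structure RewardBasedAlgorithm where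
  /-- the mixed strategy used at round `t` after the given reward vectors -/
  strategy : ∀ (T N C : ℕ) [NeZero N], Dist (Fin C) → ∀ t : Fin T,
    (Fin t → Fin N → Fin C → ℝ) → MixedStrategy N C

namespace RewardBasedAlgorithm

/-- The mixed strategy that the algorithm uses at round `t` of the game `G` repeated for `T`
rounds, when the optimizer plays the actions `i`. -/
def play (A : RewardBasedAlgorithm) {M N C T : ℕ} [NeZero N] (G : Game M N C)
    (i : Fin T → Fin M) (t : Fin T) : MixedStrategy N C :=
  A.strategy T N C G.prior t (fun s => G.uL (i (Fin.castLE t.isLt.le s)))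

/-- The polytope swap regret of the algorithm against the optimizer's actions `i`. -/
def regret (A : RewardBasedAlgorithm) {M N C T : ℕ} [NeZero N] (G : Game M N C)
    (i : Fin T → Fin M) : ℝ :=
  polytopeSwapRegret G i (A.play G i)

/-- The optimizer's total expected utility from the actions `i` against the algorithm. -/
def optimizerUtility (A : RewardBasedAlgorithm) {M N C T : ℕ} [NeZero N] (G : Game M N C)
    (i : Fin T → Fin M) : ℝ :=
  ∑ t, utilPM G.prior G.uO (i t) (A.play G i t)

end RewardBasedAlgorithm

/-- `f T = Ω(g T)` for `T → ∞`. -/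
def IsOmega (f g : ℕ → ℝ) : Prop :=
  ∃ κ : ℝ, 0 < κ ∧ ∀ᶠ T in atTop, κ * g T ≤ f T

/-- No negligible context: the probabilities of all contexts are `Ω(1)`. -/
def NoNegligibleContext {M N C : ℕ → ℕ} (G : ∀ T, Game (M T) (N T) (C T)) : Prop :=
  ∃ δ : ℝ, 0 < δ ∧ ∀ᶠ T in atTop, ∀ c, δ ≤ (G T).prior c

/-- The algorithm `A`, facing for each horizon `T` the actions `i T` in the game `G T`, is
exploitable by means of games `G' T` with `M' T` optimizer actions, the same learner actions,
contexts and prior, and optimizer actions `i' T` in it that yield the same reward vectors. -/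
def RewardBasedAlgorithm.ExploitableWith (A : RewardBasedAlgorithm) {M N C : ℕ → ℕ}
    [∀ T, NeZero (N T)] (G : ∀ T, Game (M T) (N T) (C T)) (i : ∀ T, Fin T → Fin (M T))
    (M' : ℕ → ℕ) : Prop :=
  ∃ (G' : ∀ T, Game (M' T) (N T) (C T)) (i' : ∀ T, Fin T → Fin (M' T)),
    (∀ T, (G' T).prior = (G T).prior) ∧
    (∀ T, (G' T).Normalized) ∧
    (∀ T t j c, (G' T).uL (i' T t) j c = (G T).uL (i T t) j c) ∧
    IsOmega (fun T => A.optimizerUtility (G' T) (i' T) - (G' T).stackelbergUtility * T)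
      (fun T => T)

/-- The Stackelberg utility is attained. -/
theorem isGreatest_stackelbergUtility {M N C : ℕ} [NeZero M] [NeZero N] (G : Game M N C) :
    IsGreatest G.stackelbergValues G.stackelbergUtility := by
  have hc : ∀ (u : Utility M N C) (f : PureStrategy N C),
      Continuous fun α : Dist (Fin M) => utilMP G.prior u α f := by
    intro u f
    unfold utilMP
    refine continuous_finsetSum _ fun i _ => Continuous.mul ?_ continuous_const
    exact (continuous_apply i).comp continuous_subtype_val
  have hS : G.stackelbergValues = ⋃ f : PureStrategy N C,
      (fun α => utilMP G.prior G.uO α f) '' {α | G.IsBestResponse α f} := by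
    ext v
    simp only [Game.stackelbergValues, Set.mem_iUnion, Set.mem_image, Set.mem_ofPred_eq]
    exact ⟨fun ⟨α, f, h, e⟩ => ⟨f, α, h, e.symm⟩, fun ⟨f, α, h, e⟩ => ⟨α, f, h, e.symm⟩⟩
  have hK : IsCompact G.stackelbergValues := by
    rw [hS]
    refine isCompact_iUnion fun f => IsCompact.image ?_ (hc _ f)
    refine IsClosed.isCompact ?_
    simp only [Game.IsBestResponse, Set.ofPred_forall]
    exact isClosed_iInter fun f' => isClosed_le (hc _ f') (hc _ f)
  have hne : G.stackelbergValues.Nonempty := by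
    let α : Dist (Fin M) := Classical.arbitrary _
    obtain ⟨f, hf⟩ := Finite.exists_max fun f : PureStrategy N C => utilMP G.prior G.uL α f
    exact ⟨_, α, f, hf, rfl⟩
  exact hK.isGreatest_sSup hne

/-- The polytope swap regret is attained. -/
theorem exists_polytopeSwapRegret_eq {M N C T : ℕ} (G : Game M N C) (i : Fin T → Fin M)
    (β : Fin T → MixedStrategy N C) :
    ∃ ρ : Fin T → MixedStrategy N C, (∀ t, Equivalent (β t) (ρ t)) ∧
      ∃ π : PureStrategy N C → PureStrategy N C,
        polytopeSwapRegret G i β = swapGain G i β ρ π ∧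
        ∀ π', swapGain G i β ρ π' ≤ swapGain G i β ρ π := by
  have : Nonempty (PureStrategy N C → PureStrategy N C) := ⟨id⟩
  have hcoe : ∀ (t : Fin T) (f : PureStrategy N C),
      Continuous fun ρ : Fin T → MixedStrategy N C => ρ t f := fun t f =>
    (continuous_apply f).comp (continuous_subtype_val.comp (continuous_apply t))
  have hgain : ∀ π, Continuous fun ρ : Fin T → MixedStrategy N C => swapGain G i β ρ π := by
    intro π
    unfold swapGain
    refine continuous_finsetSum _ fun t _ => Continuous.sub ?_ continuous_const
    exact continuous_finsetSum _ fun f _ => (hcoe t f).mul continuous_const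
  have hK : IsCompact {ρ : Fin T → MixedStrategy N C | ∀ t, Equivalent (β t) (ρ t)} := by
    refine IsClosed.isCompact ?_
    simp only [Equivalent, Set.ofPred_forall]
    refine isClosed_iInter fun t => isClosed_iInter fun c => isClosed_iInter fun j => ?_
    exact isClosed_eq continuous_const (continuous_finsetSum _ fun f _ => hcoe t f)
  have hmax : Continuous fun ρ : Fin T → MixedStrategy N C =>
      ⨆ π : PureStrategy N C → PureStrategy N C, swapGain G i β ρ π := by
    simp only [← Finset.sup'_univ_eq_ciSup]
    exact Continuous.finset_sup'_apply _ fun π _ => hgain π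
  obtain ⟨ρ, hρ, hmin⟩ := hK.exists_isMinOn ⟨β, fun _ _ _ => rfl⟩ hmax.continuousOn
  obtain ⟨π, hπ⟩ := Finite.exists_max fun π => swapGain G i β ρ π
  refine ⟨ρ, hρ, π, ?_, hπ⟩
  have h1 : ⨆ π : PureStrategy N C → PureStrategy N C, swapGain G i β ρ π
      = swapGain G i β ρ π :=
    le_antisymm (ciSup_le hπ) (le_ciSup (f := fun π => swapGain G i β ρ π)
      (Set.finite_range _).bddAbove π)
  rw [← h1]
  have hb : ∀ σ : {ρ : Fin T → MixedStrategy N C // ∀ t, Equivalent (β t) (ρ t)},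
      ⨆ π : PureStrategy N C → PureStrategy N C, swapGain G i β ρ π
        ≤ ⨆ π : PureStrategy N C → PureStrategy N C, swapGain G i β σ π :=
    fun σ => isMinOn_iff.1 hmin σ.1 σ.2
  have : Nonempty {ρ : Fin T → MixedStrategy N C // ∀ t, Equivalent (β t) (ρ t)} := ⟨⟨ρ, hρ⟩⟩
  have hbdd : BddBelow (Set.range fun σ : {ρ : Fin T → MixedStrategy N C //
      ∀ t, Equivalent (β t) (ρ t)} => ⨆ π, swapGain G i β σ π) :=
    ⟨_, Set.forall_mem_range.2 hb⟩
  exact le_antisymm (ciInf_le hbdd ⟨ρ, hρ⟩) (le_ciInf hb)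

end BayesGame

end

namespace BayesGame

/-- A weighted sum of marginals is an expectation of a sum over the contexts. -/
theorem sum_marginal_mul {N C : ℕ} (β : PureStrategy N C → ℝ) (q : Fin C → Fin N → ℝ) :
    ∑ c, ∑ j, (∑ f : PureStrategy N C with f c = j, β f) * q c j
      = ∑ f, β f * ∑ c, q c (f c) := by
  simp_rw [Finset.mul_sum]
  rw [Finset.sum_comm (s := Finset.univ (α := PureStrategy N C))]
  refine Finset.sum_congr rfl fun c _ => ?_
  rw [← Finset.sum_fiberwise Finset.univ (fun f : PureStrategy N C => f c)]
  refine Finset.sum_congr rfl fun j _ => ?_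
  rw [Finset.sum_mul]
  refine Finset.sum_congr rfl fun f hf => ?_
  rw [(Finset.mem_filter.1 hf).2]

/-- Equivalent strategies give the same value to every sum of functions of a single context. -/
theorem Equivalent.sum_mul_eq {N C : ℕ} {β ρ : MixedStrategy N C} (h : Equivalent β ρ)
    (q : Fin C → Fin N → ℝ) :
    ∑ f, β f * ∑ c, q c (f c) = ∑ f, ρ f * ∑ c, q c (f c) := by
  rw [← sum_marginal_mul, ← sum_marginal_mul]
  exact Finset.sum_congr rfl fun c _ => Finset.sum_congr rfl fun j _ => by rw [h c j]

/-- Every choice of representatives admits a swap that gains at least the polytope swap regret. -/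
theorem exists_polytopeSwapRegret_le {M N C T : ℕ} (G : Game M N C) (i : Fin T → Fin M)
    (β ρ : Fin T → MixedStrategy N C) (hρ : ∀ t, Equivalent (β t) (ρ t)) :
    ∃ π, polytopeSwapRegret G i β ≤ swapGain G i β ρ π := by
  have hne : Nonempty (PureStrategy N C → PureStrategy N C) := ⟨id⟩
  have hbdd : BddBelow (Set.range fun σ : {ρ : Fin T → MixedStrategy N C //
      ∀ t, Equivalent (β t) (ρ t)} => ⨆ π, swapGain G i β σ π) := by
    -- The identity swap gains zero under all representatives, since payoffs depend only on
    -- marginals.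
    refine ⟨0, Set.forall_mem_range.2 fun σ => ?_⟩
    refine le_trans (le_of_eq ?_) (le_ciSup (f := fun π => swapGain G i β σ π)
      (Set.finite_range _).bddAbove id)
    refine (Finset.sum_eq_zero fun t _ => sub_eq_zero.2 ?_).symm
    exact ((σ.2 t).sum_mul_eq fun c j => G.prior c * G.uL (i t) j c).symm
  obtain ⟨π, hπ⟩ := Finite.exists_max fun π => swapGain G i β ρ π
  exact ⟨π, (ciInf_le hbdd ⟨ρ, hρ⟩).trans (ciSup_le hπ)⟩

/-! ### Duality between representatives and mixed swaps -/

/-- Marginals of the strategies `ρ t`, together with their payoffs under all swaps. -/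
def marginalsAndPayoffs {N C T : ℕ} (u : Fin T → PureStrategy N C → ℝ) :
    (Fin T → PureStrategy N C → ℝ) →ₗ[ℝ]
      ((Fin T × Fin C × Fin N) ⊕ (PureStrategy N C → PureStrategy N C) → ℝ) where
  toFun ρ := Sum.elim
    (fun k => ∑ f : PureStrategy N C with f k.2.1 = k.2.2, ρ k.1 f)
    (fun π => ∑ t, ∑ f, ρ t f * u t (π f))
  map_add' ρ σ := by
    ext (k | π)
    · simp [Finset.sum_add_distrib]
    · simp [Finset.sum_add_distrib, add_mul]
  map_smul' a ρ := by
    ext (k | π)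
    · simp [Finset.mul_sum]
    · simp [Finset.mul_sum, mul_assoc]

/-- Used to read a separating functional as a sum over rounds of functions of `f`, so that
maximizing it decouples by round. -/
theorem sum_mul_marginalsAndPayoffs {N C T : ℕ} (u ρ : Fin T → PureStrategy N C → ℝ)
    (q : (Fin T × Fin C × Fin N) ⊕ (PureStrategy N C → PureStrategy N C) → ℝ) :
    ∑ k, marginalsAndPayoffs u ρ k * q k
      = ∑ t, ∑ f, ρ t f *
        (∑ c, q (.inl (t, c, f c)) + ∑ π, u t (π f) * q (.inr π)) := by
  simp only [Fintype.sum_sum_type, marginalsAndPayoffs, LinearMap.coe_mk, AddHom.coe_mk,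
    Sum.elim_inl, Sum.elim_inr, mul_add, Finset.sum_add_distrib, Fintype.sum_prod_type]
  congr 1
  · exact Finset.sum_congr rfl fun t _ => sum_marginal_mul (ρ t) fun c j => q (.inl (t, c, j))
  · simp_rw [Finset.sum_mul, Finset.mul_sum]
    rw [Finset.sum_comm]
    refine Finset.sum_congr rfl fun t _ => ?_
    rw [Finset.sum_comm]
    simp_rw [mul_assoc]

/-- Duality: if every choice of representatives admits a swap with payoff above `r`, then a mixed
swap and potentials below its payoffs certify the value `r`. -/
theorem exists_mixedSwap_potentials {N C T : ℕ} [NeZero N] [NeZero C]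
    (u : Fin T → PureStrategy N C → ℝ) (β : Fin T → MixedStrategy N C) (r : ℝ)
    (h : ∀ ρ : Fin T → MixedStrategy N C, (∀ t, Equivalent (β t) (ρ t)) →
      ∃ π : PureStrategy N C → PureStrategy N C, r < ∑ t, ∑ f, ρ t f * u t (π f)) :
    ∃ (μ : Dist (PureStrategy N C → PureStrategy N C)) (w : Fin T → Fin C → Fin N → ℝ),
      (∀ t f, ∑ c, w t c (f c) ≤ ∑ π, μ π * u t (π f)) ∧
      r ≤ ∑ t, ∑ f, β t f * ∑ c, w t c (f c) := by
  classical
  set Φ := marginalsAndPayoffs u with hΦ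
  let b : Fin T → PureStrategy N C → ℝ := fun t f => β t f
  let K : Set (Fin T → PureStrategy N C → ℝ) :=
    Set.univ.pi fun _ => stdSimplex ℝ (PureStrategy N C)
  let B : Set ((Fin T × Fin C × Fin N) ⊕ (PureStrategy N C → PureStrategy N C) → ℝ) :=
    {x | (∀ k, x (.inl k) = Φ b (.inl k)) ∧ ∀ π, x (.inr π) ≤ r}
  have hbK : b ∈ K := fun t _ => (β t).2
  have hKc : IsCompact (Φ '' K) :=
    (isCompact_univ_pi fun _ => isCompact_stdSimplex ℝ _).image
      (LinearMap.continuous_of_finiteDimensional Φ)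
  have hKv : Convex ℝ (Φ '' K) :=
    (convex_pi fun _ _ => convex_stdSimplex ℝ _).linear_image Φ
  have hBc : IsClosed B := by
    simp only [B, Set.ofPred_and]
    refine IsClosed.inter ?_ ?_
    · simp only [Set.ofPred_forall]
      exact isClosed_iInter fun k => isClosed_eq (continuous_apply _) continuous_const
    · simp only [Set.ofPred_forall]
      exact isClosed_iInter fun k => isClosed_le (continuous_apply _) continuous_const
  have hBv : Convex ℝ B := by
    rintro x ⟨hx, hx'⟩ y ⟨hy, hy'⟩ s t hs ht hst
    refine ⟨fun k => ?_, fun π => ?_⟩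
    · simp only [Pi.add_apply, Pi.smul_apply, smul_eq_mul, hx, hy]
      rw [← add_mul, hst, one_mul]
    · simp only [Pi.add_apply, Pi.smul_apply, smul_eq_mul]
      calc s * x (.inr π) + t * y (.inr π) ≤ s * r + t * r := by
            gcongr
            · exact hx' π
            · exact hy' π
        _ = r := by rw [← add_mul, hst, one_mul]
  have hdis : Disjoint (Φ '' K) B := by
    rw [Set.disjoint_left]
    rintro _ ⟨ρ, hρ, rfl⟩ ⟨h1, h2⟩
    obtain ⟨π, hπ⟩ := h (fun t => ⟨ρ t, hρ t trivial⟩) fun t c j => (h1 (t, c, j)).symm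
    exact absurd (h2 π) (not_le.2 hπ)
  obtain ⟨F, a, a', hFK, haa, hFB⟩ := geometric_hahn_banach_compact_closed hKv hKc hBv hBc hdis
  let q : (Fin T × Fin C × Fin N) ⊕ (PureStrategy N C → PureStrategy N C) → ℝ :=
    fun k => F fun j => if k = j then 1 else 0
  have hF : ∀ x, F x = ∑ k, x k * q k := fun x =>
    LinearMap.pi_apply_eq_sum_univ F.toLinearMap x
  have hlow : ∀ ρ ∈ K, ∑ t, ∑ f, ρ t f *
      (∑ c, q (.inl (t, c, f c)) + ∑ π, u t (π f) * q (.inr π)) < a' := fun ρ hρ => by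
    rw [← sum_mul_marginalsAndPayoffs, ← hΦ, ← hF]
    exact (hFK _ ⟨ρ, hρ, rfl⟩).trans haa
  set Q : ℝ := ∑ t, ∑ f, β t f * ∑ c, q (.inl (t, c, f c)) with hQ
  have hup : ∀ y : (PureStrategy N C → PureStrategy N C) → ℝ, (∀ π, y π ≤ r) →
      a' < Q + ∑ π, y π * q (.inr π) := fun y hy => by
    have h1 := hFB (Sum.elim (fun k => Φ b (.inl k)) y) ⟨fun _ => rfl, hy⟩
    have h2 : ∑ k, Φ b (.inl k) * q (.inl k) = Q := by
      have := sum_mul_marginalsAndPayoffs u b (Sum.elim (fun k => q (.inl k)) 0)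
      simpa [Fintype.sum_sum_type] using this
    rw [hF, Fintype.sum_sum_type] at h1
    simpa only [Sum.elim_inl, Sum.elim_inr, h2] using h1
  set l : (PureStrategy N C → PureStrategy N C) → ℝ := fun π => q (.inr π) with hl
  -- `B` is unbounded below in each payoff coordinate, so a positive coefficient would push the
  -- functional below `a'`; `s` is a shift large enough for that.
  have hnonpos : ∀ π, l π ≤ 0 := by
    intro π₀
    by_contra! hpos
    set s : ℝ := |Q + r * ∑ π, l π - a'| / l π₀ with hs
    have hs0 : 0 ≤ s := by positivity
    have h1 := hup (fun π => r - if π = π₀ then s else 0) fun π => by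
      split_ifs <;> linarith
    have h2 : ∑ π, (r - if π = π₀ then s else 0) * l π = r * ∑ π, l π - s * l π₀ := by
      simp [sub_mul, Finset.sum_sub_distrib, Finset.mul_sum]
    have h3 : s * l π₀ = |Q + r * ∑ π, l π - a'| := div_mul_cancel₀ _ hpos.ne'
    have h4 := le_abs_self (Q + r * ∑ π, l π - a')
    linarith
  have hr : a' < Q + r * ∑ π, l π := by
    simpa [Finset.mul_sum] using hup (fun _ => r) fun _ => le_rfl
  set Λ : ℝ := ∑ π, -l π with hΛ
  have hΛl : ∑ π, l π = -Λ := by simp [hΛ]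
  have hΛ0 : 0 < Λ := by
    -- If all payoff coefficients vanished, the functional would see only marginals, on which `b`
    -- agrees with `B`, giving `Q < a' < Q`.
    refine (Finset.sum_nonneg fun π _ => neg_nonneg.2 (hnonpos π)).lt_of_ne fun h0 => ?_
    have h1 : ∀ π, l π = 0 := fun π => by
      have := (Finset.sum_eq_zero_iff_of_nonneg fun π _ => neg_nonneg.2 (hnonpos π)).1 h0.symm π
        (Finset.mem_univ π)
      linarith
    have h2 := hlow b hbK
    have h3 : ∀ π, q (.inr π) = 0 := h1
    simp only [h3, mul_zero, Finset.sum_const_zero, add_zero] at h2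
    simp only [h1, Finset.sum_const_zero] at hr
    simp only [b] at h2
    linarith
  choose g hg using fun t => Finite.exists_max fun f : PureStrategy N C =>
    ∑ c, q (.inl (t, c, f c)) + ∑ π, u t (π f) * l π
  set m : Fin T → ℝ := fun t =>
    ∑ c, q (.inl (t, c, g t c)) + ∑ π, u t (π (g t)) * l π with hm
  have hsum : ∑ t, m t < a' := by
    have := hlow (fun t => Pi.single (g t) 1) fun t _ => single_mem_stdSimplex ℝ (g t)
    simpa [Pi.single_apply, hm, hl] using this
  have hC : (C : ℝ) ≠ 0 := Nat.cast_ne_zero.2 (NeZero.ne C)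
  have hw : ∀ t (f : PureStrategy N C), ∑ c, (q (.inl (t, c, f c)) - m t / C) / Λ
      = (∑ c, q (.inl (t, c, f c)) - m t) / Λ := fun t f => by
    rw [← Finset.sum_div, Finset.sum_sub_distrib, Finset.sum_const, Finset.card_univ,
      Fintype.card_fin, nsmul_eq_mul, mul_div_cancel₀ _ hC]
  -- Normalizing `-l` gives the mixed swap. Spreading the round maximum `m t` evenly over the
  -- contexts puts the potentials below the payoffs, and `∑ t, m t < a' < Q - r * Λ` gives the value
  -- `r`.
  refine ⟨⟨fun π => -l π / Λ, fun π => div_nonneg (neg_nonneg.2 (hnonpos π)) hΛ0.le, ?_⟩,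
    fun t c j => (q (.inl (t, c, j)) - m t / C) / Λ, fun t f => ?_, ?_⟩
  · rw [← Finset.sum_div, ← hΛ, div_self hΛ0.ne']
  · rw [hw]
    have h1 : ∑ π, -l π / Λ * u t (π f) = (-∑ π, u t (π f) * l π) / Λ := by
      rw [← Finset.sum_neg_distrib, Finset.sum_div]
      exact Finset.sum_congr rfl fun π _ => by ring
    refine le_of_le_of_eq ?_ h1.symm
    have := hg t f
    gcongr
    simp only [hm]
    linarith
  · simp only [hw]
    have h1 : ∑ t, ∑ f, β t f * ((∑ c, q (.inl (t, c, f c)) - m t) / Λ)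
        = (Q - ∑ t, m t) / Λ := by
      rw [hQ, ← Finset.sum_sub_distrib, Finset.sum_div]
      refine Finset.sum_congr rfl fun t _ => ?_
      have h2 : ∑ f, β t f = 1 := (β t).2.2
      have h3 : ∑ f, β t f * m t = m t := by rw [← Finset.sum_mul, h2, one_mul]
      nth_rewrite 2 [← h3]
      rw [← Finset.sum_sub_distrib, Finset.sum_div]
      exact Finset.sum_congr rfl fun f _ => by ring
    rw [h1, le_div_iff₀ hΛ0]
    rw [hΛl] at hr
    linarith

/-! ### Truncation of the potentials -/

/-- Potentials below a payoff with values in `[-1, 1]` can be replaced by potentials with values in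
`[-3, 3]`, without lowering their expectation under any mixed strategy. -/
theorem exists_bounded_potentials {N C : ℕ} [NeZero N] [NeZero C] (w : Fin C → Fin N → ℝ)
    (v : PureStrategy N C → ℝ) (hv : ∀ f, v f ∈ Set.Icc (-1 : ℝ) 1)
    (h : ∀ f : PureStrategy N C, ∑ c, w c (f c) ≤ v f) :
    ∃ w' : Fin C → Fin N → ℝ, (∀ c j, |w' c j| ≤ 3) ∧
      ∀ f : PureStrategy N C, ∑ c, w' c (f c) ≤ v f ∧ ∑ c, w c (f c) ≤ ∑ c, w' c (f c) := by
  choose g hg using fun c => Finite.exists_max (w c)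
  set a : ℝ := ∑ c, w c (g c) with ha
  have ha1 : a ≤ 1 := (h g).trans (hv g).2
  have hC : (0 : ℝ) < C := Nat.cast_pos.2 (NeZero.pos C)
  have hC1 : (1 : ℝ) ≤ C := Nat.one_le_cast.2 (NeZero.pos C)
  have hmax1 : max a (-1) ≤ 1 := max_le ha1 (by norm_num)
  have hshift : |max a (-1) / C| ≤ 1 := by
    rw [abs_div, abs_of_pos hC, div_le_one hC]
    exact (abs_le.2 ⟨le_max_right _ _, hmax1⟩).trans hC1
  have hsum : ∀ f : PureStrategy N C,
      ∑ c, (max (w c (f c) - w c (g c)) (-2) + max a (-1) / C)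
        = ∑ c, max (w c (f c) - w c (g c)) (-2) + max a (-1) := fun f => by
    rw [Finset.sum_add_distrib, Finset.sum_const, Finset.card_univ, Fintype.card_fin,
      nsmul_eq_mul, mul_div_cancel₀ _ hC.ne']
  have hle : ∀ c j, max (w c j - w c (g c)) (-2) ≤ 0 := fun c j =>
    max_le (sub_nonpos.2 (hg c j)) (by norm_num)
  -- Each context is shifted to have maximum 0 and cut at -2; the top value `a`, raised to at least
  -- -1, is then shared among the contexts.
  refine ⟨fun c j => max (w c j - w c (g c)) (-2) + max a (-1) / C, fun c j => ?_, fun f => ?_⟩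
  · have h1 := abs_le.1 hshift
    have h2 := le_max_right (w c j - w c (g c)) (-2)
    have h3 := hle c j
    exact abs_le.2 ⟨by linarith, by linarith⟩
  · rw [hsum]
    constructor
    -- One cut context already brings the sum to at most -2 + 1 = -1, a lower bound of `v`.
    · by_cases htr : ∃ c, w c (f c) - w c (g c) < -2
      · obtain ⟨c, hc⟩ := htr
        have h1 : ∑ c, max (w c (f c) - w c (g c)) (-2) ≤ -2 := by
          refine (Finset.sum_le_sum (g := fun c' => if c' = c then (-2 : ℝ) else 0)
            fun c' _ => ?_).trans (by simp)
          split_ifs with hc'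
          · rw [hc', max_eq_right hc.le]
          · exact hle _ _
        linarith [(hv f).1]
      · push Not at htr
        have h1 : ∑ c, max (w c (f c) - w c (g c)) (-2) = ∑ c, w c (f c) - a := by
          rw [ha, ← Finset.sum_sub_distrib]
          exact Finset.sum_congr rfl fun c _ => max_eq_left (htr c)
        have h2 : ∑ c, max (w c (f c) - w c (g c)) (-2) ≤ 0 :=
          Finset.sum_nonpos fun c _ => hle _ _
        rcases le_total a (-1) with h3 | h3
        · rw [max_eq_right h3]
          linarith [(hv f).1]
        · rw [max_eq_left h3, h1]
          linarith [h f]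
    · have h1 : ∑ c, w c (f c) - a ≤ ∑ c, max (w c (f c) - w c (g c)) (-2) := by
        rw [ha, ← Finset.sum_sub_distrib]
        exact Finset.sum_le_sum fun c _ => le_max_left _ _
      linarith [le_max_left a (-1)]

/-! ### The exploiting utility -/

/-- An average of values in `[-1, 1]` lies in `[-1, 1]`. -/
theorem Dist.sum_mul_mem_Icc {X : Type} [Fintype X] (μ : Dist X) (v : X → ℝ)
    (hv : ∀ x, v x ∈ Set.Icc (-1 : ℝ) 1) : ∑ x, μ x * v x ∈ Set.Icc (-1 : ℝ) 1 := by
  have hp : ∑ x, μ x = 1 := μ.2.2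
  have h0 : ∀ x, 0 ≤ μ x := μ.2.1
  constructor
  · rw [← hp, ← Finset.sum_neg_distrib]
    exact Finset.sum_le_sum fun x _ => by nlinarith [h0 x, (hv x).1]
  · rw [← hp]
    exact Finset.sum_le_sum fun x _ => by nlinarith [h0 x, (hv x).2]

theorem utilPP_mem_Icc {M N C : ℕ} (p : Dist (Fin C)) (u : Utility M N C)
    (hu : ∀ i j c, u i j c ∈ Set.Icc (-1 : ℝ) 1) (i : Fin M) (f : PureStrategy N C) :
    utilPP p u i f ∈ Set.Icc (-1 : ℝ) 1 :=
  Dist.sum_mul_mem_Icc p _ fun c => hu i (f c) c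

/-- The game in which the optimizer's actions are the rounds of the play `i` of `G`. -/
def roundsGame {M N C T : ℕ} (G : Game M N C) (i : Fin T → Fin M) (uO : Utility T N C) :
    Game T N C where
  prior := G.prior
  uO := uO
  uL t := G.uL (i t)

/-- A large polytope swap regret yields an optimizer utility whose Stackelberg value is at most
zero, but which is large on the play. -/
theorem exists_exploiting_utility {M N C T : ℕ} [NeZero N] (G : Game M N C) (hG : G.Normalized)
    (i : Fin T → Fin M) (β : Fin T → MixedStrategy N C) {δ r : ℝ} (hδ : 0 < δ)
    (hp : ∀ c, δ ≤ G.prior c) (hr : r < polytopeSwapRegret G i β) :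
    ∃ uO : Utility T N C, (roundsGame G i uO).Normalized ∧
      (roundsGame G i uO).stackelbergUtility ≤ 0 ∧
      δ / (3 + δ) * r ≤ ∑ t, utilPM G.prior uO t (β t) := by
  have hsum : ∑ c, G.prior c = 1 := G.prior.2.2
  have : NeZero C := ⟨by
    rintro rfl
    simp at hsum⟩
  have hL : ∀ i j c, G.uL i j c ∈ Set.Icc (-1 : ℝ) 1 := fun i j c => (hG i j c).2
  set U : ℝ := ∑ t, utilPM G.prior G.uL (i t) (β t) with hU
  obtain ⟨μ, w, hw, hwr⟩ := exists_mixedSwap_potentials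
    (fun t f => utilPP G.prior G.uL (i t) f) β (r + U) fun ρ hρ => by
      obtain ⟨π, hπ⟩ := exists_polytopeSwapRegret_le G i β ρ hρ
      refine ⟨π, ?_⟩
      rw [swapGain, Finset.sum_sub_distrib] at hπ
      linarith
  choose w' hw'b hw' using fun t => exists_bounded_potentials (w t)
    (fun f => ∑ π, μ π * utilPP G.prior G.uL (i t) (π f))
    (fun f => Dist.sum_mul_mem_Icc μ _ fun π => utilPP_mem_Icc _ _ hL _ _) (hw t)
  -- The inverse of `3 / δ + 1`, which bounds potential over prior plus learner utility.
  set K : ℝ := δ / (3 + δ) with hK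
  have hK0 : 0 < K := by positivity
  have hpos : ∀ c, 0 < G.prior c := fun c => hδ.trans_le (hp c)
  -- Dividing by the prior cancels its weight in the expected utility, leaving the plain sum of
  -- potentials.
  let uO : Utility T N C := fun t j c => K * (w' t c j / G.prior c - G.uL (i t) j c)
  have hPP : ∀ t f, utilPP G.prior uO t f
      = K * (∑ c, w' t c (f c) - utilPP G.prior G.uL (i t) f) := fun t f => by
    rw [utilPP, utilPP, ← Finset.sum_sub_distrib, Finset.mul_sum]
    refine Finset.sum_congr rfl fun c _ => ?_
    have := (hpos c).ne'
    simp only [uO]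
    field_simp
  refine ⟨uO, fun t j c => ⟨?_, hL _ _ _⟩, ?_, ?_⟩
  · have h1 : |w' t c j / G.prior c| ≤ 3 / δ := by
      rw [abs_div, abs_of_pos (hpos c)]
      gcongr
      · exact hw'b t c j
      · exact hp c
    have h2 : |G.uL (i t) j c| ≤ 1 := abs_le.2 (hL _ _ _)
    refine abs_le.1 ?_
    change |K * _| ≤ 1
    rw [abs_mul, abs_of_pos hK0]
    calc K * |w' t c j / G.prior c - G.uL (i t) j c| ≤ K * (3 / δ + 1) := by
          gcongr
          exact (abs_sub _ _).trans (add_le_add h1 h2)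
      _ = 1 := by
          rw [hK]
          field_simp
  · refine Real.sSup_nonpos ?_
    rintro _ ⟨α, f, hf, rfl⟩
    have hα : ∀ t, 0 ≤ α t := α.2.1
    have hμ : ∀ π, 0 ≤ μ π := μ.2.1
    have hμ1 : ∑ π, μ π = 1 := μ.2.2
    have hbest : ∑ t, α t * ∑ π, μ π * utilPP G.prior G.uL (i t) (π f)
        ≤ ∑ t, α t * utilPP G.prior G.uL (i t) f := by
      calc ∑ t, α t * ∑ π, μ π * utilPP G.prior G.uL (i t) (π f)
          = ∑ π, μ π * ∑ t, α t * utilPP G.prior G.uL (i t) (π f) := by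
            simp_rw [Finset.mul_sum]
            rw [Finset.sum_comm]
            exact Finset.sum_congr rfl fun π _ => Finset.sum_congr rfl fun t _ => by ring
        _ ≤ ∑ π, μ π * ∑ t, α t * utilPP G.prior G.uL (i t) f :=
            Finset.sum_le_sum fun π _ => mul_le_mul_of_nonneg_left (hf (π f)) (hμ π)
        _ = ∑ t, α t * utilPP G.prior G.uL (i t) f := by
            rw [← Finset.sum_mul, hμ1, one_mul]
    calc utilMP G.prior uO α f
        = K * (∑ t, α t * ∑ c, w' t c (f c) - ∑ t, α t * utilPP G.prior G.uL (i t) f) := by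
          rw [utilMP, ← Finset.sum_sub_distrib, Finset.mul_sum]
          exact Finset.sum_congr rfl fun t _ => by rw [hPP]; ring
      _ ≤ K * 0 := by
          refine mul_le_mul_of_nonneg_left (sub_nonpos.2 (le_trans ?_ hbest)) hK0.le
          exact Finset.sum_le_sum fun t _ => mul_le_mul_of_nonneg_left (hw' t f).1 (hα t)
      _ = 0 := mul_zero K
  · have h1 : ∑ t, utilPM G.prior uO t (β t)
        = K * (∑ t, ∑ f, β t f * ∑ c, w' t c (f c) - U) := by
      rw [hU, ← Finset.sum_sub_distrib, Finset.mul_sum]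
      refine Finset.sum_congr rfl fun t _ => ?_
      rw [utilPM, utilPM, ← Finset.sum_sub_distrib, Finset.mul_sum]
      exact Finset.sum_congr rfl fun f _ => by rw [hPP]; ring
    have h2 : ∑ t, ∑ f, β t f * ∑ c, w t c (f c) ≤ ∑ t, ∑ f, β t f * ∑ c, w' t c (f c) :=
      Finset.sum_le_sum fun t _ => Finset.sum_le_sum fun f _ =>
        mul_le_mul_of_nonneg_left (hw' t f).2 ((β t).2.1 f)
    rw [h1]
    exact mul_le_mul_of_nonneg_left (by linarith) hK0.le

end BayesGame

theorem theorem5 (A : BayesGame.RewardBasedAlgorithm) {M N C : ℕ → ℕ} [∀ T, NeZero (N T)]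
    (G : ∀ T, BayesGame.Game (M T) (N T) (C T)) (i : ∀ T, Fin T → Fin (M T))
    (hG : ∀ T, (G T).Normalized)
    (hctx : BayesGame.NoNegligibleContext G)
    (hreg : BayesGame.IsOmega (fun T => A.regret (G T) (i T)) (fun T => T)) :
    A.ExploitableWith G i (fun T => T) := by
  obtain ⟨δ, hδ, hctx⟩ := hctx
  obtain ⟨κ, hκ, hreg⟩ := hreg
  have hK : 0 < δ / (3 + δ) * (κ / 2) := by positivity
  have key : ∀ T, ∃ uO : BayesGame.Utility T (N T) (C T),
      (BayesGame.roundsGame (G T) (i T) uO).Normalized ∧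
      ((∀ c, δ ≤ (G T).prior c) → κ * T ≤ A.regret (G T) (i T) → 0 < T →
        (BayesGame.roundsGame (G T) (i T) uO).stackelbergUtility ≤ 0 ∧
        δ / (3 + δ) * (κ / 2 * T)
          ≤ ∑ t, BayesGame.utilPM (G T).prior uO t (A.play (G T) (i T) t)) := by
    intro T
    by_cases h : (∀ c, δ ≤ (G T).prior c) ∧ κ * T ≤ A.regret (G T) (i T) ∧ 0 < T
    · obtain ⟨hp, hr, hT⟩ := h
      -- Halving `κ` provides the strict inequality needed for separation.
      have hlt : κ / 2 * T < A.regret (G T) (i T) := by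
        have : 0 < κ * T := mul_pos hκ (Nat.cast_pos.2 hT)
        linarith
      obtain ⟨uO, h1, h2, h3⟩ := BayesGame.exists_exploiting_utility (G T) (hG T) (i T)
        (A.play (G T) (i T)) hδ hp hlt
      exact ⟨uO, h1, fun _ _ _ => ⟨h2, h3⟩⟩
    -- For the finitely many remaining horizons any normalized game will do.
    · refine ⟨fun _ _ _ => 0, fun t j c => ⟨by simp [BayesGame.roundsGame], (hG T _ j c).2⟩, ?_⟩
      exact fun h1 h2 h3 => absurd ⟨h1, h2, h3⟩ h
  choose uO hnorm hexp using key
  refine ⟨fun T => BayesGame.roundsGame (G T) (i T) (uO T), fun _ t => t, fun _ => rfl, hnorm,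
    fun _ _ _ _ => rfl, δ / (3 + δ) * (κ / 2), hK, ?_⟩
  filter_upwards [hctx, hreg, eventually_gt_atTop 0] with T h1 h2 h3
  obtain ⟨hV, hO⟩ := hexp T h1 h2 h3
  have hVT := mul_nonpos_of_nonpos_of_nonneg hV (Nat.cast_nonneg (α := ℝ) T)
  have hO' : δ / (3 + δ) * (κ / 2 * T) ≤ A.optimizerUtility
    (BayesGame.roundsGame (G T) (i T) (uO T)) fun t => t := hO
  linarith
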